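/- Let $(X,d)$ be a compact metric space and $T:X\to X$ a continuous map. Let $\mathcal M_T$ be the set of $T$-invariant Borel probability measures on $X$, and for $B\in C^0(X)$ put $\beta_B=\max_{\mu\in\mathcal M_T}\int B\,d\mu$. Assume that - $T$ is topologically transitive, and - $T$ is weakly expanding: $K\mapsto T^{-1}(K)$ is $1$-Lipschitz on the compact subsets of $X$ with respect to the Hausdorff distance. A continuous function $f$ on $X$ with values in $\mathbb R$ or $\mathbb R^n$ is called a Walters function if there is a non-decreasing $H:[0,\infty)\to[0,\infty]$, with $H(0)=0$ and $H$ continuous at $0$, such that for all $s\ge 0$, all $k\ge 1$ and all $x,y\in X$, $$\max_{0\le j<k}d(T^jx,T^jy)\le s\ \Longrightarrow\ \Big\|\sum_{j=0}^{k-1}f(T^jx)-\sum_{j=0}^{k-1}f(T^jy)\Big\|\le H(s).$$ Let $A\in C^0(X)$ and $\varphi=(\varphi_1,\dots,\varphi_n)\in C^0(X,\mathbb R^n)$ be Walters functions. For $\mu\in\mathcal M_T$ put $\varphi_*(\mu)=\big(\int\varphi_1\,d\mu,\dots,\int\varphi_n\,d\mu\big)$, and define $$\beta_{A,\varphi}(h)=\sup\Big\{\int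 A\,d\mu:\ \mu\in\mathcal M_T,\ \varphi_*(\mu)=h\Big\}\quad (h\in\varphi_*(\mathcal M_T)),$$ $$\alpha_{A,\varphi}(c)=\min_{h\in\varphi_*(\mathcal M_T)}\big[\langle c,h\rangle-\beta_{A,\varphi}(h)\big]\quad (c\in\mathbb R^n).$$ Let $c\in\mathbb R^n$ and $B=A-\langle c,\varphi\rangle$. Let $u\in C^0(X)$ be a calibrated sub-action for $B$, that is, $B+u-u\circ T\le\beta_B$ on $X$ and $u(y)=\max_{T(x)=y}\big(B(x)+u(x)-\beta_B\big)$ for every $y\in X$. Let $\{x_j\}_{j\ge 0}\subset X$ be an optimal trajectory for $u$, that is, for every $j\ge 0$, $$T(x_{j+1})=x_j\quad\text{and}\quad u(x_j)=B(x_{j+1})+u(x_{j+1})-\beta_B.$$ If $\alpha_{A,\varphi}:\mathbb R^n\to\mathbb R$ is differentiable at $c$, then $$\lim_{k\to\infty}\frac1k\sum_{j=0}^{k-1}\varphi(x_j)=D\alpha_{A,\varphi}(c),$$ where the differential $D\alpha_{A,\varphi}(c)$ is identified with the gradient vector in $\mathbb R^n$. -/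

import Mathlib

open MeasureTheory Filter Topology
open scoped NNReal ENNReal

namespace RelMax

/-- `T` is topologically transitive. -/
def IsTransitive {X : Type*} [TopologicalSpace X] (T : C(X, X)) : Prop :=
  ∀ U V : Set X, IsOpen U → U.Nonempty → IsOpen V → V.Nonempty →
    ∃ m : ℕ, (U ∩ (⇑T)^[m] ⁻¹' V).Nonempty

/-- The map `K ↦ T⁻¹(K)` on the compact subsets of a compact metric space. -/
def preimageCompacts {X : Type*} [MetricSpace X] [CompactSpace X] (T : C(X, X))
    (K : TopologicalSpace.Compacts X) : TopologicalSpace.Compacts X :=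
  ⟨T ⁻¹' (K : Set X), (K.isCompact.isClosed.preimage T.continuous).isCompact⟩

/-- Weak expansion: `T⁻¹` is 1-Lipschitz on the compact subsets for the Hausdorff distance. -/
def IsWeaklyExpanding {X : Type*} [MetricSpace X] [CompactSpace X] (T : C(X, X)) : Prop :=
  LipschitzWith 1 (preimageCompacts T)

/-- `d_k(x, y) = max_{0 ≤ j < k} d(T^j x, T^j y)`. -/
noncomputable def dynDist {X : Type*} [MetricSpace X] (T : C(X, X)) (k : ℕ) (x y : X) : ℝ≥0 :=
  (Finset.range k).sup fun j => nndist ((⇑T)^[j] x) ((⇑T)^[j] y)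

/-- Walters functions. For `E = ℝ` the norm is the absolute value; for `E = ℝⁿ` the condition is
equivalent to every coordinate function being a Walters function. -/
def IsWalters {X : Type*} [MetricSpace X] {E : Type*} [NormedAddCommGroup E]
    (T : C(X, X)) (f : C(X, E)) : Prop :=
  ∃ H : ℝ≥0 → ℝ≥0∞, Monotone H ∧ H 0 = 0 ∧ ContinuousAt H 0 ∧
    ∀ (s : ℝ≥0) (k : ℕ), 0 < k → ∀ x y : X, dynDist T k x y ≤ s →
      ‖birkhoffSum T f k x - birkhoffSum T f k y‖ₑ ≤ H s

section Measures

variable {X : Type*} [MetricSpace X] [MeasurableSpace X]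

/-- The set of `T`-invariant Borel probability measures. -/
def invariantMeasures (T : C(X, X)) : Set (ProbabilityMeasure X) :=
  {μ | MeasurePreserving T (μ : Measure X) (μ : Measure X)}

/-- `β_A`, the maximal integral of `A` over the invariant probability measures. -/
noncomputable def maxIntegral (T : C(X, X)) (A : C(X, ℝ)) : ℝ :=
  sSup ((fun μ : ProbabilityMeasure X => ∫ x, A x ∂(μ : Measure X)) '' invariantMeasures T)

/-- The rotation vector `φ_*(μ) = (∫ φ₁ dμ, …, ∫ φₙ dμ)`. -/
noncomputable def rotationVector {n : ℕ} (φ : C(X, EuclideanSpace ℝ (Fin n)))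
    (μ : ProbabilityMeasure X) : EuclideanSpace ℝ (Fin n) :=
  WithLp.toLp 2 fun i => ∫ x, φ x i ∂(μ : Measure X)

/-- The rotation set, the image of the invariant probability measures under `φ_*`. -/
def rotationSet {n : ℕ} (T : C(X, X)) (φ : C(X, EuclideanSpace ℝ (Fin n))) :
    Set (EuclideanSpace ℝ (Fin n)) :=
  rotationVector φ '' invariantMeasures T

/-- The beta function; it is meaningful for `h` in the rotation set. -/
noncomputable def betaFun {n : ℕ} (T : C(X, X)) (A : C(X, ℝ))
    (φ : C(X, EuclideanSpace ℝ (Fin n))) (h : EuclideanSpace ℝ (Fin n)) : ℝ :=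
  sSup ((fun μ : ProbabilityMeasure X => ∫ x, A x ∂(μ : Measure X)) ''
    {μ | μ ∈ invariantMeasures T ∧ rotationVector φ μ = h})

/-- The alpha function, the concave Fenchel transform of the beta function. -/
noncomputable def alphaFun {n : ℕ} (T : C(X, X)) (A : C(X, ℝ))
    (φ : C(X, EuclideanSpace ℝ (Fin n))) (c : EuclideanSpace ℝ (Fin n)) : ℝ :=
  sInf ((fun h => inner ℝ c h - betaFun T A φ h) '' rotationSet T φ)

/-- The potential `A - ⟨c, φ⟩`. -/
noncomputable def tilted {n : ℕ} (A : C(X, ℝ)) (φ : C(X, EuclideanSpace ℝ (Fin n)))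
    (c : EuclideanSpace ℝ (Fin n)) : C(X, ℝ) where
  toFun x := A x - inner ℝ c (φ x)
  continuous_toFun := by fun_prop

/-- `u` is a sub-action for `A`. -/
def IsSubaction (T : C(X, X)) (A u : C(X, ℝ)) : Prop :=
  ∀ x, A x + u x - u (T x) ≤ maxIntegral T A

/-- `u` is a calibrated sub-action for `A`: a sub-action with
`u(y) = max_{T x = y} (A + u - β_A)(x)` for every `y`, the maximum being attained. -/
def IsCalibratedSubaction (T : C(X, X)) (A u : C(X, ℝ)) : Prop :=
  IsSubaction T A u ∧
    ∀ y, IsGreatest ((fun x => A x + u x - maxIntegral T A) '' {x | T x = y}) (u y)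

/-- `x₀, x₁, …` is an optimal trajectory for the potential `A` and the calibrated
sub-action `u`. -/
def IsOptimalTrajectory (T : C(X, X)) (A u : C(X, ℝ)) (x : ℕ → X) : Prop :=
  ∀ j, T (x (j + 1)) = x j ∧ u (x j) = A (x (j + 1)) + u (x (j + 1)) - maxIntegral T A

end Measures

end RelMax

namespace RelMax

section Empirical

variable {X : Type*} [MetricSpace X] [CompactSpace X] [MeasurableSpace X] [BorelSpace X]

/-! Let `B = tilted A φ c`. Any weak limit `μ` of the empirical measures of the trajectory is
invariant, and since calibration makes the sums of `B` telescope up to a bounded error, `μ`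
maximizes `∫ B`. By Fenchel duality the rotation vector of a maximizing measure is a supergradient
of `alphaFun` at `c` (`alphaFun_le_add_inner`); differentiability leaves only the gradient. All
limit points of the averages thus coincide, and compactness gives convergence. -/

theorem integrable_continuousMap (f : C(X, ℝ)) (μ : ProbabilityMeasure X) :
    Integrable (fun y => f y) (μ : Measure X) :=
  (BoundedContinuousFunction.mkOfCompact f).integrable (μ : Measure X)

/-- The empirical measure of a finite orbit segment. -/
theorem exists_empirical_measure (x : ℕ → X) {k : ℕ} (hk : k ≠ 0) :
    ∃ μ : ProbabilityMeasure X, ∀ f : C(X, ℝ),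
      ∫ y, f y ∂(μ : Measure X) = (k : ℝ)⁻¹ * ∑ j ∈ Finset.range k, f (x j) := by
  have hk' : (k : ℝ≥0∞) ≠ 0 := by exact_mod_cast hk
  refine ⟨⟨(k : ℝ≥0∞)⁻¹ • ∑ j ∈ Finset.range k, Measure.dirac (x j), ⟨?_⟩⟩, fun f => ?_⟩
  · simp [ENNReal.inv_mul_cancel hk' (ENNReal.natCast_ne_top k)]
  · have hint : ∀ j ∈ Finset.range k, Integrable (fun y => f y) (Measure.dirac (x j)) :=
      fun j _ => (BoundedContinuousFunction.mkOfCompact f).integrable _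
    simp only [ProbabilityMeasure.coe_mk]
    rw [integral_smul_measure, integral_finsetSum_measure hint]
    simp

/-- Along an ultrafilter finer than `atTop`, the Birkhoff averages of any sequence of points are
the integrals against a single probability measure. -/
theorem exists_tendsto_average (x : ℕ → X) (U : Ultrafilter ℕ) (hU : (U : Filter ℕ) ≤ atTop) :
    ∃ μ : ProbabilityMeasure X, ∀ f : C(X, ℝ),
      Tendsto (fun k : ℕ => (k : ℝ)⁻¹ * ∑ j ∈ Finset.range k, f (x j)) U
        (𝓝 (∫ y, f y ∂(μ : Measure X))) := by
  have hex : ∀ k : ℕ, ∃ μ : ProbabilityMeasure X, k ≠ 0 → ∀ f : C(X, ℝ),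
      ∫ y, f y ∂(μ : Measure X) = (k : ℝ)⁻¹ * ∑ j ∈ Finset.range k, f (x j) := by
    intro k
    by_cases hk : k = 0
    · obtain ⟨μ, -⟩ := exists_empirical_measure x one_ne_zero
      exact ⟨μ, fun h => absurd hk h⟩
    · obtain ⟨μ, hμ⟩ := exists_empirical_measure x hk
      exact ⟨μ, fun _ => hμ⟩
  choose ν hν using hex
  -- The space of probability measures on a compact metric space is weakly compact.
  obtain ⟨μ, -, hμ⟩ := isCompact_univ.ultrafilter_le_nhds (U.map ν) (by simp)
  have hlim : Tendsto ν U (𝓝 μ) := hμ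
  refine ⟨μ, fun f => ?_⟩
  have h := ProbabilityMeasure.tendsto_iff_forall_integral_tendsto.1 hlim
    (BoundedContinuousFunction.mkOfCompact f)
  refine Tendsto.congr' ?_ h
  filter_upwards [hU (eventually_ne_atTop 0)] with k hk
  exact hν k hk f

theorem tendsto_inv_mul_bounded {w : ℕ → ℝ} {C : ℝ} (hw : ∀ k, |w k| ≤ C) :
    Tendsto (fun k : ℕ => (k : ℝ)⁻¹ * w k) atTop (𝓝 0) :=
  (tendsto_inv_atTop_nhds_zero_nat (𝕜 := ℝ)).zero_mul_isBoundedUnder_le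
    ⟨C, by simpa using ⟨0, fun k _ => hw k⟩⟩

/-- Limits of empirical measures along a backward orbit are invariant. -/
theorem mem_invariantMeasures_of_backward_orbit (T : C(X, X)) {x : ℕ → X}
    (hx : ∀ j, T (x (j + 1)) = x j) {F : Filter ℕ} [F.NeBot] (hF : F ≤ atTop)
    {μ : ProbabilityMeasure X}
    (hμ : ∀ f : C(X, ℝ), Tendsto (fun k : ℕ => (k : ℝ)⁻¹ * ∑ j ∈ Finset.range k, f (x j)) F
        (𝓝 (∫ y, f y ∂(μ : Measure X)))) :
    μ ∈ invariantMeasures T := by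
  refine ⟨T.continuous.measurable, ?_⟩
  have : IsProbabilityMeasure ((μ : Measure X).map T) :=
    Measure.isProbabilityMeasure_map T.continuous.measurable.aemeasurable
  refine ext_of_forall_integral_eq_of_IsFiniteMeasure fun f => ?_
  rw [integral_map T.continuous.measurable.aemeasurable f.continuous.aestronglyMeasurable]
  have h1 := hμ (f.toContinuousMap.comp T)
  have h2 := hμ f.toContinuousMap
  -- `T` shifts the backward orbit by one index, so only the two end terms change.
  have hsum : ∀ k : ℕ, ∑ j ∈ Finset.range k, f (T (x j)) =
      ∑ j ∈ Finset.range k, f (x j) + (f (T (x 0)) - f (T (x k))) := by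
    intro k
    induction k with
    | zero => simp
    | succ k ih => rw [Finset.sum_range_succ, ih, Finset.sum_range_succ, hx k]; ring
  have h0 : Tendsto (fun k : ℕ => (k : ℝ)⁻¹ * (f (T (x 0)) - f (T (x k)))) F (𝓝 0) :=
    (tendsto_inv_mul_bounded (C := ‖f‖ + ‖f‖) fun k => (norm_sub_le _ _).trans
      (add_le_add (f.norm_coe_le_norm _) (f.norm_coe_le_norm _))).mono_left hF
  have h3 := h2.add h0
  rw [add_zero] at h3
  refine tendsto_nhds_unique h1 (h3.congr fun k => ?_)
  change (k : ℝ)⁻¹ * ∑ j ∈ Finset.range k, f (x j) + _ =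
    (k : ℝ)⁻¹ * ∑ j ∈ Finset.range k, f (T (x j))
  rw [hsum]; ring

/-- The Birkhoff averages of the potential along an optimal trajectory tend to its maximal
integral. -/
theorem IsOptimalTrajectory.tendsto_average {T : C(X, X)} {B u : C(X, ℝ)} {x : ℕ → X}
    (hx : IsOptimalTrajectory T B u x) :
    Tendsto (fun k : ℕ => (k : ℝ)⁻¹ * ∑ j ∈ Finset.range k, B (x j)) atTop
      (𝓝 (maxIntegral T B)) := by
  -- Optimality gives `B (x j) = maxIntegral T B + (B + u) (x j) - (B + u) (x (j + 1))`, which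
  -- telescopes.
  have hsum : ∀ k : ℕ, ∑ j ∈ Finset.range k, B (x j) =
      k * maxIntegral T B + (B (x 0) + u (x 0) - (B (x k) + u (x k))) := by
    intro k
    induction k with
    | zero => simp
    | succ k ih => rw [Finset.sum_range_succ, ih, (hx k).2]; push_cast; ring
  have h0 : Tendsto (fun k : ℕ => (k : ℝ)⁻¹ * ((B + u) (x 0) - (B + u) (x k))) atTop (𝓝 0) :=
    tendsto_inv_mul_bounded (C := ‖B + u‖ + ‖B + u‖) fun k => (norm_sub_le _ _).trans
      (add_le_add ((B + u).norm_coe_le_norm _) ((B + u).norm_coe_le_norm _))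
  have h1 := h0.const_add (maxIntegral T B)
  rw [add_zero] at h1
  refine h1.congr' ?_
  filter_upwards [eventually_ne_atTop 0] with k hk
  rw [hsum]
  simp only [ContinuousMap.add_apply]
  field_simp

theorem abs_integral_le (f : C(X, ℝ)) (μ : ProbabilityMeasure X) :
    |∫ y, f y ∂(μ : Measure X)| ≤ ‖f‖ := by
  simpa using norm_integral_le_of_norm_le_const (μ := (μ : Measure X))
    (Eventually.of_forall fun y => f.norm_coe_le_norm y)

theorem bddAbove_integral_image (f : C(X, ℝ)) (s : Set (ProbabilityMeasure X)) :
    BddAbove ((fun μ : ProbabilityMeasure X => ∫ y, f y ∂(μ : Measure X)) '' s) := by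
  refine ⟨‖f‖, ?_⟩
  rintro _ ⟨μ, -, rfl⟩
  exact (le_abs_self _).trans (abs_integral_le f μ)

theorem integral_tilted {n : ℕ} (A : C(X, ℝ)) (φ : C(X, EuclideanSpace ℝ (Fin n)))
    (c : EuclideanSpace ℝ (Fin n)) (μ : ProbabilityMeasure X) :
    ∫ y, tilted A φ c y ∂(μ : Measure X) =
      ∫ y, A y ∂(μ : Measure X) - inner ℝ c (rotationVector φ μ) := by
  have hi : ∀ i, Integrable (fun y => φ y i) (μ : Measure X) := fun i =>
    integrable_continuousMap ⟨fun y => φ y i, by fun_prop⟩ μ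
  have hc : Integrable (fun y => inner ℝ c (φ y)) (μ : Measure X) :=
    integrable_continuousMap ⟨fun y => inner ℝ c (φ y), by fun_prop⟩ μ
  change ∫ y, (A y - inner ℝ c (φ y)) ∂(μ : Measure X) = _
  rw [integral_sub (integrable_continuousMap A μ) hc]
  congr 1
  simp only [PiLp.inner_apply, rotationVector, RCLike.inner_apply, conj_trivial]
  rw [integral_finsetSum _ fun i _ => (hi i).mul_const _]
  simp only [integral_mul_const]

theorem betaFun_le {n : ℕ} (T : C(X, X)) (A : C(X, ℝ)) (φ : C(X, EuclideanSpace ℝ (Fin n)))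
    (c : EuclideanSpace ℝ (Fin n)) {h : EuclideanSpace ℝ (Fin n)} (hh : h ∈ rotationSet T φ) :
    betaFun T A φ h ≤ maxIntegral T (tilted A φ c) + inner ℝ c h := by
  obtain ⟨μ, hμ, hμh⟩ := hh
  refine csSup_le ⟨_, μ, ⟨hμ, hμh⟩, rfl⟩ ?_
  rintro _ ⟨ν, ⟨hν, rfl⟩, rfl⟩
  have hle : ∫ y, tilted A φ c y ∂(ν : Measure X) ≤ maxIntegral T (tilted A φ c) :=
    le_csSup (bddAbove_integral_image _ _) ⟨ν, hν, rfl⟩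
  rw [integral_tilted] at hle
  simpa using sub_le_iff_le_add.1 hle

/-- The half of the duality `alphaFun = -maxIntegral` needed at the base point `c`; the upper bound
`alphaFun_le` serves at the other points `c'`. -/
theorem neg_maxIntegral_le_alphaFun {n : ℕ} {T : C(X, X)} (hne : (invariantMeasures T).Nonempty)
    (A : C(X, ℝ)) (φ : C(X, EuclideanSpace ℝ (Fin n))) (c : EuclideanSpace ℝ (Fin n)) :
    -maxIntegral T (tilted A φ c) ≤ alphaFun T A φ c := by
  refine le_csInf ((hne.image _).image _) ?_
  rintro _ ⟨h, hh, rfl⟩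
  have := betaFun_le T A φ c hh
  dsimp only
  linarith

theorem alphaFun_le {n : ℕ} {T : C(X, X)} (A : C(X, ℝ)) (φ : C(X, EuclideanSpace ℝ (Fin n)))
    (c : EuclideanSpace ℝ (Fin n)) {μ : ProbabilityMeasure X} (hμ : μ ∈ invariantMeasures T) :
    alphaFun T A φ c ≤ inner ℝ c (rotationVector φ μ) - ∫ y, A y ∂(μ : Measure X) := by
  -- A real `sInf` bounds from below only when the set is bounded below.
  have hb : BddBelow ((fun h => inner ℝ c h - betaFun T A φ h) '' rotationSet T φ) := by
    refine ⟨-maxIntegral T (tilted A φ c), ?_⟩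
    rintro _ ⟨h, hh, rfl⟩
    have := betaFun_le T A φ c hh
    dsimp only
    linarith
  have h1 : alphaFun T A φ c ≤
      inner ℝ c (rotationVector φ μ) - betaFun T A φ (rotationVector φ μ) :=
    csInf_le hb ⟨_, ⟨μ, hμ, rfl⟩, rfl⟩
  have h2 : ∫ y, A y ∂(μ : Measure X) ≤ betaFun T A φ (rotationVector φ μ) :=
    le_csSup (bddAbove_integral_image _ _) ⟨μ, ⟨hμ, rfl⟩, rfl⟩
  linarith

/-- The rotation vector of a measure maximizing the tilted potential is a supergradient of the
alpha function. -/
theorem alphaFun_le_add_inner {n : ℕ} {T : C(X, X)} (A : C(X, ℝ))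
    (φ : C(X, EuclideanSpace ℝ (Fin n))) (c c' : EuclideanSpace ℝ (Fin n))
    {μ : ProbabilityMeasure X} (hμ : μ ∈ invariantMeasures T)
    (hmax : ∫ y, tilted A φ c y ∂(μ : Measure X) = maxIntegral T (tilted A φ c)) :
    alphaFun T A φ c' ≤ alphaFun T A φ c + inner ℝ (rotationVector φ μ) (c' - c) := by
  have h1 := neg_maxIntegral_le_alphaFun ⟨μ, hμ⟩ A φ c
  have h2 := alphaFun_le A φ c' hμ
  rw [integral_tilted] at hmax
  rw [inner_sub_right, real_inner_comm c', real_inner_comm c]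
  linarith

end Empirical

/-- A supergradient at a point of differentiability is the gradient. -/
theorem eq_gradient_of_supergradient {E : Type*} [NormedAddCommGroup E] [InnerProductSpace ℝ E]
    [CompleteSpace E] {f : E → ℝ} {c g : E} (hf : DifferentiableAt ℝ f c)
    (hg : ∀ c', f c' ≤ f c + inner ℝ g (c' - c)) : g = gradient f c := by
  have hd : HasFDerivAt (fun c' => f c' - inner ℝ g (c' - c))
      (fderiv ℝ f c - innerSL ℝ g) c := by
    refine hf.hasFDerivAt.sub ?_
    exact (innerSL ℝ g).hasFDerivAt.comp c ((hasFDerivAt_id c).sub_const c)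
  -- Subtracting the supporting linear function turns `c` into a global maximum, where the
  -- derivative vanishes.
  have hmax : IsLocalMax (fun c' => f c' - inner ℝ g (c' - c)) c :=
    Eventually.of_forall fun c' => by
      have := hg c'
      simp only [sub_self, inner_zero_right, sub_zero]
      linarith
  have h0 := sub_eq_zero.1 (hmax.hasFDerivAt_eq_zero hd)
  refine ext_inner_right ℝ fun v => ?_
  have := congrArg (fun L => L v) h0
  rw [← toDual_gradient] at this
  simpa using this.symm

end RelMax

theorem theorem17 {X : Type*} [MetricSpace X] [CompactSpace X] [MeasurableSpace X] [BorelSpace X]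
    (T : C(X, X)) (hT : RelMax.IsTransitive T) (hexp : RelMax.IsWeaklyExpanding T)
    {n : ℕ} (A : C(X, ℝ)) (hA : RelMax.IsWalters T A)
    (φ : C(X, EuclideanSpace ℝ (Fin n))) (hφ : RelMax.IsWalters T φ)
    (c : EuclideanSpace ℝ (Fin n))
    (u : C(X, ℝ)) (hu : RelMax.IsCalibratedSubaction T (RelMax.tilted A φ c) u)
    (x : ℕ → X) (hx : RelMax.IsOptimalTrajectory T (RelMax.tilted A φ c) u x)
    (hα : DifferentiableAt ℝ (RelMax.alphaFun T A φ) c) :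
    Tendsto (fun k : ℕ => (k : ℝ)⁻¹ • ∑ j ∈ Finset.range k, φ (x j)) atTop
      (𝓝 (gradient (RelMax.alphaFun T A φ) c)) := by
  -- Ultrafilters replace subsequences: `μ` depends on `U`, but the limit of the averages does not.
  refine (tendsto_iff_ultrafilter _ _ _).2 fun U hU => ?_
  obtain ⟨μ, hμ⟩ := RelMax.exists_tendsto_average x U hU
  have hinv := RelMax.mem_invariantMeasures_of_backward_orbit T (fun j => (hx j).1) hU hμ
  have hmax := tendsto_nhds_unique (hμ (RelMax.tilted A φ c)) (hx.tendsto_average.mono_left hU)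
  rw [← RelMax.eq_gradient_of_supergradient hα
    fun c' => RelMax.alphaFun_le_add_inner A φ c c' hinv hmax]
  have hcoord : Tendsto (fun (k : ℕ) (i : Fin n) => (k : ℝ)⁻¹ * ∑ j ∈ Finset.range k, φ (x j) i) U
      (𝓝 fun i => ∫ y, φ y i ∂(μ : Measure X)) :=
    tendsto_pi_nhds.2 fun i => hμ ⟨fun y => φ y i, by fun_prop⟩
  refine (((PiLp.continuous_toLp 2 _).tendsto _).comp hcoord).congr fun k => ?_
  ext i
  simp
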